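/- \textbf{Bodyguards and Presidents} is played on the vertices of a graph $G$. One player controls a set of tokens, the bodyguards; the other controls a single token, the president. First the bodyguards are placed on vertices (several may share a vertex), then the president is placed on a vertex. Then the players alternate turns, the bodyguards first. In a turn, a player may, for each of his or her tokens, move it to an adjacent vertex or leave it where it is; all positions are visible to both players. The president is \emph{surrounded} if every vertex of the open neighbourhood of his vertex is occupied by a bodyguard. The bodyguards win if the president is surrounded at the end of all but finitely many bodyguard turns; otherwise the president wins. The \emph{bodyguard number} $B(G)$ is the least number of bodyguards that have a winning strategy on $G$. Let $Q_k$ be the $k$-dimensional hypercube: its vertices are the vectors in $\{0,1\}^k$, two of them being adjacent if and only if they differ in exactly one coordinate. \textbf{Theorem.} If $k \ge 3$, then \[ k+1 \;\le\; B(Q_k) \;\le\; \left\lfloor \frac{3k}{2} \right\rfloor . \] -/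

import Mathlib

/-- The `k`-dimensional hypercube: the vertices are the 0/1-vectors of length `k`, and two of them
are adjacent when they differ in exactly one coordinate. -/
def hypercube (k : ℕ) : SimpleGraph (Fin k → Bool) where
  Adj x y := hammingDist x y = 1
  symm := ⟨fun x y h => by rw [hammingDist_comm]; exact h⟩
  loopless := ⟨fun x h => by simp at h⟩

namespace BodyguardsAndPresidents

variable {V : Type*}

/-- A token may move from `x` to `y` in one turn: it stays where it is or moves along an edge. -/
def Step (G : SimpleGraph V) (x y : V) : Prop := x = y ∨ G.Adj x y

/-- A strategy for `m` bodyguards: an initial placement (several bodyguards may share a vertex),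
and a rule which, given the list `h` of all the vertices the president has occupied so far (his
starting vertex first, his current vertex last) and the current placement `b` of the bodyguards,
yields the placement after the bodyguards' next turn. In each turn every bodyguard stays or moves
along an edge. -/
structure Strategy (G : SimpleGraph V) (m : ℕ) where
  start : Fin m → V
  move : List V → (Fin m → V) → (Fin m → V)
  legal : ∀ (h : List V) (b : Fin m → V) (i : Fin m), Step G (b i) (move h b i)

/-- An infinite sequence of legal president positions: he starts on `p 0` (any vertex, chosen after
the bodyguards have been placed), and in each turn he stays or moves along an edge. -/
def IsPresidentPlay (G : SimpleGraph V) (p : ℕ → V) : Prop :=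
  ∀ t : ℕ, Step G (p t) (p (t + 1))

/-- The placement of the bodyguards after `t` bodyguard turns, if they follow the strategy `σ` and
the president plays `p`. The game proceeds as follows: the bodyguards are placed, the president
starts on `p 0`, the bodyguards take their first turn, the president moves to `p 1`, the bodyguards
take their second turn, and so on. So when taking turn number `t + 1` the bodyguards know
`p 0, …, p t`. -/
def Strategy.position {G : SimpleGraph V} {m : ℕ} (σ : Strategy G m) (p : ℕ → V) :
    ℕ → Fin m → V
  | 0 => σ.start
  | t + 1 => σ.move ((List.range (t + 1)).map p) (σ.position p t)

/-- The president on `v` is surrounded by bodyguards placed according to `b`: every vertex of the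
open neighbourhood of `v` is occupied by a bodyguard. -/
def Surrounded (G : SimpleGraph V) {m : ℕ} (b : Fin m → V) (v : V) : Prop :=
  ∀ u : V, G.Adj v u → ∃ i : Fin m, b i = u

/-- The strategy `σ` wins: however the president plays, he is surrounded at the end of all but
finitely many bodyguard turns. At the end of bodyguard turn number `t + 1` he is on `p t`. -/
def Strategy.IsWinning {G : SimpleGraph V} {m : ℕ} (σ : Strategy G m) : Prop :=
  ∀ p : ℕ → V, IsPresidentPlay G p →
    ∃ N : ℕ, ∀ t : ℕ, N ≤ t → Surrounded G (σ.position p (t + 1)) (p t)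

/-- `m` bodyguards suffice to win Bodyguards and Presidents on `G`. -/
def BodyguardsWin (G : SimpleGraph V) (m : ℕ) : Prop :=
  ∃ σ : Strategy G m, σ.IsWinning

/-- The bodyguard number `B(G)`: the least number of bodyguards that suffice to win on `G`
(`⊤` if no finite number suffices). -/
noncomputable def bodyguardNumber (G : SimpleGraph V) : ℕ∞ :=
  ⨅ (m : ℕ) (_ : BodyguardsWin G m), (m : ℕ∞)

end BodyguardsAndPresidents

/-!
*Lower bound.* For `k ≥ 3` the president can stay at distance at least `2` from one fixed bodyguard
at the end of every bodyguard turn: if the distance is exactly `2`, he changes a coordinate in which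
they agree. That bodyguard never helps, so `k` others are needed to surround him.

*Upper bound.* Record bodyguard `i` by the set `D i` of coordinates in which he differs from the
president; when the president changes a coordinate, a bodyguard can change it as well and keep his
set. The potential is `∑ |D i|` plus twice the number of unoccupied neighbours of the president.
With `⌊3k/2⌋` bodyguards, either at least `k` of them satisfy `|D i| ≤ 1`, and while the president
is not surrounded one of those can be spared to decrease the potential, or more than `k/2` of them
satisfy `|D i| ≥ 2`, and two of these large sets overlap. In the latter case some bodyguard can come
closer, unless the president changes a coordinate outside all of the large sets; then one of the two
overlapping bodyguards trades a common coordinate for the new one, which does not increase the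
potential and enlarges the union of the large sets.
-/

namespace BodyguardsAndPresidents

open scoped symmDiff

section Game

variable {V : Type*} {G : SimpleGraph V} {m : ℕ}

theorem Strategy.position_congr (σ : Strategy G m) {p q : ℕ → V} {t : ℕ}
    (hpq : ∀ s < t, p s = q s) : σ.position p t = σ.position q t := by
  induction t with
  | zero => rfl
  | succ t ih =>
    have hhistory : (List.range (t + 1)).map p = (List.range (t + 1)).map q :=
      List.map_congr_left fun s hs => hpq s (List.mem_range.1 hs)
    rw [position, position, hhistory, ih fun s hs => hpq s (hs.trans t.lt_succ_self)]

/-- The play of a president who starts on `v₀` and, seeing the placement `b` from the vertex `v`,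
moves to `f b v`, against bodyguards following `σ`. The truncation `min s t` makes the recursion
refer to earlier vertices only. -/
def Strategy.playAgainst (σ : Strategy G m) (v₀ : V) (f : (Fin m → V) → V → V) : ℕ → V
  | 0 => v₀
  | t + 1 => f (σ.position (fun s => σ.playAgainst v₀ f (min s t)) (t + 1)) (σ.playAgainst v₀ f t)

theorem Strategy.playAgainst_succ (σ : Strategy G m) (v₀ : V) (f : (Fin m → V) → V → V) (t : ℕ) :
    σ.playAgainst v₀ f (t + 1) =
      f (σ.position (σ.playAgainst v₀ f) (t + 1)) (σ.playAgainst v₀ f t) := by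
  rw [playAgainst]
  congr 1
  exact σ.position_congr fun s hs => by rw [min_eq_left (Nat.le_of_lt_succ hs)]

theorem Strategy.exists_play_of_invariant (σ : Strategy G m) (P : (Fin m → V) → V → Prop)
    (hstart : ∃ v, ∀ h, P (σ.move h σ.start) v)
    (hstep : ∀ b v, P b v → ∃ w, Step G v w ∧ ∀ h, P (σ.move h b) w) :
    ∃ p, IsPresidentPlay G p ∧ ∀ t, P (σ.position p (t + 1)) (p t) := by
  obtain ⟨v₀, hv₀⟩ := hstart
  have : Nonempty V := ⟨v₀⟩
  choose! f hf hfP using hstep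
  have hP (t : ℕ) : P (σ.position (σ.playAgainst v₀ f) (t + 1)) (σ.playAgainst v₀ f t) := by
    induction t with
    | zero => rw [playAgainst]; exact hv₀ _
    | succ t ih =>
      rw [playAgainst_succ]
      exact hfP _ _ ih _
  refine ⟨σ.playAgainst v₀ f, fun t => ?_, hP⟩
  rw [playAgainst_succ]
  exact hf _ _ (hP t)

theorem BodyguardsWin.pos_of_adj (h : BodyguardsWin G m) {u v : V} (huv : G.Adj v u) : 0 < m := by
  obtain ⟨σ, hσ⟩ := h
  obtain ⟨N, hN⟩ := hσ (fun _ => v) fun _ => Or.inl rfl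
  obtain ⟨i, -⟩ := hN N le_rfl u huv
  exact i.pos

theorem Surrounded.degree_lt [G.LocallyFinite] {b : Fin m → V} {v : V} (h : Surrounded G b v)
    {i : Fin m} (hi : ¬ G.Adj v (b i)) : G.degree v < m := by
  classical
  have hsub : G.neighborFinset v ⊆ (Finset.univ.erase i).image b := fun u hu => by
    have hvu := (G.mem_neighborFinset v u).1 hu
    obtain ⟨j, rfl⟩ := h u hvu
    have hji : j ≠ i := fun hji => hi (hji ▸ hvu)
    exact Finset.mem_image_of_mem b (Finset.mem_erase.2 ⟨hji, Finset.mem_univ j⟩)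
  calc G.degree v ≤ (Finset.univ.erase i).card :=
        (Finset.card_le_card hsub).trans Finset.card_image_le
    _ < m := by simpa using Finset.card_erase_lt_of_mem (Finset.mem_univ i)

/-- On `G`, a president who is neither on the vertex of a given bodyguard nor adjacent to it at the
end of a bodyguard turn can move so that the same holds at the end of the next one. -/
def CanEvade (G : SimpleGraph V) : Prop :=
  ∀ x v, ¬ Step G x v → ∃ w, Step G v w ∧ ∀ y, Step G x y → ¬ Step G y w

theorem CanEvade.exists_degree_lt [G.LocallyFinite] (hG : CanEvade G)
    (hfar : ∀ x, ∃ v, ¬ Step G x v) (hm : 0 < m) (h : BodyguardsWin G m) :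
    ∃ v, G.degree v < m := by
  obtain ⟨σ, hσ⟩ := h
  let i : Fin m := ⟨0, hm⟩
  obtain ⟨p, hp, hevade⟩ := σ.exists_play_of_invariant (fun b v => ¬ Step G (b i) v)
    (by
      obtain ⟨v, hv⟩ := hfar (σ.start i)
      obtain ⟨w, -, hw⟩ := hG _ v hv
      exact ⟨w, fun h => hw _ (σ.legal h _ i)⟩)
    fun b v hbv => (hG _ v hbv).imp fun w hw => ⟨hw.1, fun h => hw.2 _ (σ.legal h b i)⟩
  obtain ⟨N, hN⟩ := hσ p hp
  exact ⟨p N, (hN N le_rfl).degree_lt fun hadj => hevade N (Or.inr hadj.symm)⟩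

theorem bodyguardsWin_of_response [Nonempty V] (f : (Fin m → V) → V → V → Fin m → V)
    (hlegal : ∀ b v w i, Step G (b i) (f b v w i))
    (hwin : ∀ (p : ℕ → V) (b : ℕ → Fin m → V), IsPresidentPlay G p →
      (∀ t, b (t + 1) = f (b t) (p t) (p (t + 1))) →
      ∃ N, ∀ t, N ≤ t → Surrounded G (b t) (p t)) :
    BodyguardsWin G m := by
  let v₀ : V := Classical.arbitrary V
  let σ : Strategy G m :=
    { start := fun _ => v₀
      move := fun h b => f b (h.dropLast.getLast?.getD v₀) (h.getLast?.getD v₀)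
      legal := fun h b => hlegal b _ _ }
  refine ⟨σ, fun p hp => hwin p (fun t => σ.position p (t + 1)) hp fun t => ?_⟩
  change σ.move ((List.range (t + 2)).map p) (σ.position p (t + 1)) = _
  simp [σ, List.range_succ]

theorem bodyguardsWin_of_potential [Nonempty V] {α : Type*} [Preorder α] [WellFoundedLT α]
    (μ : (Fin m → V) → V → α)
    (hkeep : ∀ b v w, Step G v w → Surrounded G b v →
      ∃ b' : Fin m → V, (∀ i, Step G (b i) (b' i)) ∧ Surrounded G b' w)
    (hdrop : ∀ b v w, Step G v w → ¬ Surrounded G b v →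
      ∃ b' : Fin m → V, (∀ i, Step G (b i) (b' i)) ∧ μ b' w < μ b v) :
    BodyguardsWin G m := by
  have hresponse : ∀ b v w, ∃ b' : Fin m → V, (∀ i, Step G (b i) (b' i)) ∧
      (Step G v w → Surrounded G b v → Surrounded G b' w) ∧
      (Step G v w → ¬ Surrounded G b v → μ b' w < μ b v) := by
    intro b v w
    by_cases hvw : Step G v w
    · by_cases hS : Surrounded G b v
      · obtain ⟨b', hlegal, hS'⟩ := hkeep b v w hvw hS
        exact ⟨b', hlegal, fun _ _ => hS', fun _ hn => absurd hS hn⟩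
      · obtain ⟨b', hlegal, hlt⟩ := hdrop b v w hvw hS
        exact ⟨b', hlegal, fun _ h => absurd h hS, fun _ _ => hlt⟩
    · exact ⟨b, fun _ => Or.inl rfl, fun h => absurd h hvw, fun h => absurd h hvw⟩
  choose f hlegal hfkeep hfdrop using hresponse
  refine bodyguardsWin_of_response f hlegal fun p b hp hb => ?_
  obtain ⟨N, hN⟩ : ∃ N, Surrounded G (b N) (p N) := by
    by_contra! hnever
    obtain ⟨t, ht⟩ := WellFounded.not_rel_apply_succ (r := ((· < ·) : α → α → Prop))
      fun t => μ (b t) (p t)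
    exact ht (hb t ▸ hfdrop _ _ _ (hp t) (hnever t))
  refine ⟨N, fun t ht => ?_⟩
  induction t, ht using Nat.le_induction with
  | base => exact hN
  | succ t _ ih => exact hb t ▸ hfkeep _ _ _ (hp t) ih

end Game

section RelativePositions

variable {ι α : Type*} {D : ι → Finset α} {s : ι} {X A : Finset α}

/-- After the president has changed the coordinates in `X`, legal moves of the bodyguards take
the sets of differing coordinates from `D` to `D'`. -/
def IsAnswer [DecidableEq α] (X : Finset α) (D D' : ι → Finset α) : Prop :=
  ∀ i, (D i ∆ X ∆ D' i).card ≤ 1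

theorem isAnswer_self [DecidableEq α] (hX : X.card ≤ 1) (D : ι → Finset α) :
    IsAnswer X D D := fun i => by
  rwa [symmDiff_comm (D i), symmDiff_symmDiff_cancel_right]

theorem IsAnswer.update [DecidableEq ι] [DecidableEq α] {D' : ι → Finset α} (h : IsAnswer X D D')
    (hA : (D s ∆ X ∆ A).card ≤ 1) : IsAnswer X D (Function.update D' s A) := fun i => by
  rcases eq_or_ne i s with rfl | hi
  · simpa using hA
  · simpa [hi] using h i

/-- Every neighbour of the president that bodyguard `s` occupies is also occupied by another
bodyguard, so that `s` can be used elsewhere. -/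
def IsSpare (D : ι → Finset α) (s : ι) : Prop := ∀ j, D s = {j} → ∃ g, g ≠ s ∧ D g = {j}

theorem isSpare_of_two_le_card (hs : 2 ≤ (D s).card) : IsSpare D s := fun j hj => by
  rw [hj, Finset.card_singleton] at hs
  omega

variable [Fintype ι]

theorem sum_card_update [DecidableEq ι] (D : ι → Finset α) (s : ι) (A : Finset α) :
    ∑ i, (Function.update D s A i).card + (D s).card = ∑ i, (D i).card + A.card := by
  have hcard (i : ι) : (Function.update D s A i).card =
      Function.update (fun i => (D i).card) s A.card i :=
    Function.apply_update (fun _ => Finset.card) D s A i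
  simp only [hcard, Finset.sum_update_of_mem (Finset.mem_univ s)]
  rw [Finset.sum_eq_add_sum_sdiff_singleton_of_mem (Finset.mem_univ s) fun i => (D i).card]
  omega

/-- The bodyguards at distance at least two from the president. -/
def farGuards (D : ι → Finset α) : Finset ι := {i | 2 ≤ (D i).card}

theorem mem_farGuards {i : ι} : i ∈ farGuards D ↔ 2 ≤ (D i).card := by
  simp [farGuards]

theorem exists_farGuards_overlap [Fintype α] (hfar : Fintype.card α < 2 * (farGuards D).card) :
    ∃ g ∈ farGuards D, ∃ g' ∈ farGuards D, g ≠ g' ∧ ∃ j, j ∈ D g ∧ j ∈ D g' := by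
  classical
  by_contra! hno
  have hdisj : (farGuards D : Set ι).PairwiseDisjoint D := fun g hg g' hg' hne =>
    Finset.disjoint_left.2 fun j hj => hno g hg g' hg' hne j hj
  have hsum : (farGuards D).card * 2 ≤ ∑ g ∈ farGuards D, (D g).card :=
    Finset.card_nsmul_le_sum _ _ 2 fun g hg => mem_farGuards.1 hg
  have hunion := Finset.card_le_univ ((farGuards D).biUnion D)
  rw [Finset.card_biUnion hdisj] at hunion
  omega

variable [DecidableEq α]

/-- The coordinates in which some far bodyguard differs from the president. If the president changes
one of them, a far bodyguard gets closer by staying where he is. -/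
def watched (D : ι → Finset α) : Finset α := (farGuards D).biUnion D

theorem mem_watched {j : α} : j ∈ watched D ↔ ∃ i, 2 ≤ (D i).card ∧ j ∈ D i := by
  simp [watched, farGuards]

theorem watched_ssubset_update [DecidableEq ι] {g : ι} (hg : g ∈ farGuards D) (hgs : g ≠ s)
    {j : α} (hjg : j ∈ D g) {a : α} (ha : a ∉ watched D)
    (hA : 2 ≤ A.card) (haA : a ∈ A) (hDA : (D s).erase j ⊆ A) :
    watched D ⊂ watched (Function.update D s A) := by
  have hkeep : ∀ {i l}, i ≠ s → 2 ≤ (D i).card → l ∈ D i → l ∈ watched (Function.update D s A) :=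
    fun {i l} his hi hl => mem_watched.2 ⟨i, by simpa [his] using hi, by simpa [his] using hl⟩
  have hs_new : A ⊆ watched (Function.update D s A) := fun l hl =>
    mem_watched.2 ⟨s, by simpa using hA, by simpa using hl⟩
  refine (Finset.ssubset_iff_of_subset fun l hl => ?_).2 ⟨a, hs_new haA, ha⟩
  obtain ⟨i, hi, hli⟩ := mem_watched.1 hl
  rcases eq_or_ne i s with rfl | his
  · rcases eq_or_ne l j with rfl | hlj
    · exact hkeep hgs (mem_farGuards.1 hg) hjg
    · exact hs_new (hDA (Finset.mem_erase.2 ⟨hlj, hli⟩))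
  · exact hkeep his hi hli

variable [Fintype α]

/-- The coordinates that lead from the president to an unoccupied neighbour, if bodyguard `i`
differs from the president in the coordinates in `D i`. -/
def unoccupied (D : ι → Finset α) : Finset α := {j | ∀ i, D i ≠ {j}}

theorem mem_unoccupied {j : α} : j ∈ unoccupied D ↔ ∀ i, D i ≠ {j} := by
  simp [unoccupied]

theorem exists_isSpare [DecidableEq ι] (hclose : Fintype.card α ≤ (farGuards D)ᶜ.card)
    (hunocc : (unoccupied D).Nonempty) : ∃ s, (D s).card ≤ 1 ∧ IsSpare D s := by
  obtain ⟨u, hu⟩ := hunocc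
  rw [mem_unoccupied] at hu
  by_contra! hnone
  have hsole : ∀ i ∈ (farGuards D)ᶜ, ∃ j, D i = {j} ∧ ∀ g, g ≠ i → D g ≠ {j} := by
    intro i hi
    rw [Finset.mem_compl, mem_farGuards, not_le] at hi
    simpa [IsSpare] using hnone i (Nat.le_of_lt_succ hi)
  have hle : (farGuards D)ᶜ.card ≤
      ((Finset.univ.erase u).image fun j => ({j} : Finset α)).card := by
    refine Finset.card_le_card_of_injOn D (fun i hi => ?_) fun i hi i' _ hii' => ?_
    · obtain ⟨j, hj, -⟩ := hsole i hi
      have hju : j ≠ u := fun hju => hu i (hju ▸ hj)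
      simpa [hj] using hju
    · obtain ⟨j, hj, hjsole⟩ := hsole i hi
      by_contra hne
      exact hjsole i' (Ne.symm hne) (hii' ▸ hj)
  have hlt : (Finset.univ.erase u).card < Fintype.card α :=
    Finset.card_erase_lt_of_mem (Finset.mem_univ u)
  exact absurd (hclose.trans (hle.trans Finset.card_image_le)) hlt.not_ge

theorem IsSpare.unoccupied_update_subset [DecidableEq ι] (hs : IsSpare D s) (A : Finset α) :
    unoccupied (Function.update D s A) ⊆ unoccupied D := fun j hj => by
  simp only [mem_unoccupied] at hj ⊢
  intro i hi
  obtain ⟨g, hgs, hg⟩ : ∃ g, g ≠ s ∧ D g = {j} := by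
    rcases eq_or_ne i s with rfl | his
    · exact hs j hi
    · exact ⟨i, his, hi⟩
  exact hj g (by rwa [Function.update_of_ne hgs])

/-- The main part of the potential. An unoccupied neighbour counts twice so that occupying it pays
for the distance that one bodyguard may lose. -/
def weight (D : ι → Finset α) : ℕ := ∑ i, (D i).card + 2 * (unoccupied D).card

theorem IsSpare.weight_update_le [DecidableEq ι] (hs : IsSpare D s) (A : Finset α) :
    weight (Function.update D s A) + (D s).card ≤ weight D + A.card := by
  have hsum := sum_card_update D s A
  have hunocc := Finset.card_le_card (hs.unoccupied_update_subset A)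
  simp only [weight]
  omega

theorem IsSpare.weight_update_singleton_lt [DecidableEq ι] (hs : IsSpare D s) {u : α}
    (hu : u ∈ unoccupied D) :
    weight (Function.update D s {u}) + (D s).card < weight D := by
  have hsum := sum_card_update D s {u}
  have hunocc : (unoccupied (Function.update D s {u})).card < (unoccupied D).card := by
    refine Finset.card_lt_card ((Finset.ssubset_iff_of_subset
      (hs.unoccupied_update_subset {u})).2 ⟨u, hu, fun hu' => ?_⟩)
    exact mem_unoccupied.1 hu' s (Function.update_self ..)
  rw [Finset.card_singleton] at hsum
  simp only [weight]
  omega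

theorem IsSpare.exists_answer_empty_weight_lt (hs : IsSpare D s) (hcard : (D s).card ≤ 1)
    (hunocc : (unoccupied D).Nonempty) : ∃ D', IsAnswer ∅ D D' ∧ weight D' < weight D := by
  classical
  obtain ⟨u, hu⟩ := hunocc
  have hstay : IsAnswer ∅ D D := isAnswer_self (by simp) D
  rcases Nat.le_one_iff_eq_zero_or_eq_one.1 hcard with h0 | h1
  · have hlt := hs.weight_update_singleton_lt hu
    have hlegal : (D s ∆ ∅ ∆ {u}).card ≤ 1 := by simp [Finset.card_eq_zero.1 h0, symmDiff_def]
    exact ⟨_, hstay.update hlegal, by omega⟩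
  · have hle := hs.weight_update_le ∅
    rw [Finset.card_empty] at hle
    have hlegal : (D s ∆ ∅ ∆ ∅).card ≤ 1 := by simpa [symmDiff_def] using hcard
    exact ⟨_, hstay.update hlegal, by omega⟩

theorem IsSpare.exists_answer_singleton_weight_lt (hs : IsSpare D s) (hcard : (D s).card ≤ 1)
    (hunocc : (unoccupied D).Nonempty) (a : α) :
    ∃ D', IsAnswer {a} D D' ∧ weight D' < weight D := by
  classical
  -- Bodyguard `s` moves to the vertex that the president has just left. A bodyguard `g` on whose
  -- vertex the president has just arrived can go on to any neighbour of the president.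
  have hs_follows : IsAnswer {a} D (Function.update D s {a}) :=
    (isAnswer_self (by simp) D).update (by rwa [symmDiff_symmDiff_cancel_right])
  by_cases hg : ∃ g, g ≠ s ∧ D g = {a}
  · obtain ⟨g, hgs, hg⟩ := hg
    obtain ⟨u, hu⟩ := hunocc
    have hg_spare : IsSpare (Function.update D s {a}) g := fun j hj =>
      ⟨s, hgs.symm, by rw [← hj, Function.update_self, Function.update_of_ne hgs, hg]⟩
    have hu' : u ∈ unoccupied (Function.update D s {a}) := mem_unoccupied.2 fun i => by
      rcases eq_or_ne i s with rfl | his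
      · simpa [hg] using mem_unoccupied.1 hu g
      · simpa [his] using mem_unoccupied.1 hu i
    have hle := hs.weight_update_le {a}
    have hlt := hg_spare.weight_update_singleton_lt hu'
    rw [Function.update_of_ne hgs, hg] at hlt
    have hlegal : (D g ∆ {a} ∆ {u}).card ≤ 1 := by simp [hg, symmDiff_def]
    exact ⟨_, hs_follows.update hlegal, by omega⟩
  · have ha : a ∈ unoccupied D := mem_unoccupied.2 fun i hi => by
      rcases eq_or_ne i s with rfl | his
      · exact hg (hs a hi)
      · exact hg ⟨i, his, hi⟩
    have hlt := hs.weight_update_singleton_lt ha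
    exact ⟨_, hs_follows, by omega⟩

theorem exists_answer_weight_lt_of_mem (hs : 2 ≤ (D s).card) {j : α} (hj : j ∈ D s) (hX : X ⊆ {j}) :
    ∃ D', IsAnswer X D D' ∧ weight D' < weight D := by
  classical
  have hX1 : X.card ≤ 1 := (Finset.card_le_card hX).trans_eq (Finset.card_singleton j)
  have hmove : D s ∆ X ∆ (D s).erase j ⊆ {j} := fun a ha => by
    have haX := @hX a
    simp only [Finset.mem_symmDiff, Finset.mem_erase, Finset.mem_singleton] at ha haX ⊢
    tauto
  have hle := (isSpare_of_two_le_card hs).weight_update_le ((D s).erase j)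
  have hlt := Finset.card_erase_lt_of_mem hj
  exact ⟨_, (isAnswer_self hX1 D).update ((Finset.card_le_card hmove).trans_eq
    (Finset.card_singleton j)), by omega⟩

/-- The potential that the bodyguards decrease until the president is surrounded. -/
def potential (D : ι → Finset α) : ℕ ×ₗ ℕ := toLex (weight D, (watched D)ᶜ.card)

theorem potential_lt_of_weight_lt {D' : ι → Finset α} (h : weight D' < weight D) :
    potential D' < potential D :=
  Prod.Lex.toLex_lt_toLex.2 (Or.inl h)

theorem potential_lt_of_watched_ssubset {D' : ι → Finset α} (hweight : weight D' ≤ weight D)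
    (hwatched : watched D ⊂ watched D') : potential D' < potential D :=
  Prod.Lex.toLex_lt_toLex'.2 ⟨hweight, fun _ =>
    Finset.card_lt_card (Finset.compl_ssubset_compl.2 hwatched)⟩

theorem exists_answer_potential_lt_of_notMem_watched
    (hfar : Fintype.card α < 2 * (farGuards D).card) {a : α} (ha : a ∉ watched D) :
    ∃ D', IsAnswer {a} D D' ∧ potential D' < potential D := by
  classical
  obtain ⟨s, hs, g, hg, hsg, j, hjs, hjg⟩ := exists_farGuards_overlap hfar
  have has : a ∉ D s := fun h => ha (mem_watched.2 ⟨s, mem_farGuards.1 hs, h⟩)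
  set A := insert a ((D s).erase j) with hA
  have hcard : A.card = (D s).card := by
    rw [hA, Finset.card_insert_of_notMem (fun h => has (Finset.mem_of_mem_erase h)),
      Finset.card_erase_add_one hjs]
  have hmove : D s ∆ {a} ∆ A ⊆ {j} := fun b hb => by
    rcases eq_or_ne b a with rfl | hba
    · simp [Finset.mem_symmDiff, hA, has] at hb
    · simp only [hA, Finset.mem_symmDiff, Finset.mem_erase, Finset.mem_singleton,
        Finset.mem_insert] at hb ⊢
      tauto
  have hle := (isSpare_of_two_le_card (mem_farGuards.1 hs)).weight_update_le A
  refine ⟨_, (isAnswer_self (by simp) D).update ((Finset.card_le_card hmove).trans_eq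
    (Finset.card_singleton j)), potential_lt_of_watched_ssubset (by omega) ?_⟩
  exact watched_ssubset_update hg hsg.symm hjg ha (hcard ▸ mem_farGuards.1 hs)
    (Finset.mem_insert_self a _) (Finset.subset_insert a _)

theorem exists_answer_potential_lt (hcard : 3 * Fintype.card α / 2 ≤ Fintype.card ι)
    (hX : X.card ≤ 1) (hunocc : (unoccupied D).Nonempty) :
    ∃ D', IsAnswer X D D' ∧ potential D' < potential D := by
  classical
  have hweight : (∃ D', IsAnswer X D D' ∧ weight D' < weight D) →
      ∃ D', IsAnswer X D D' ∧ potential D' < potential D :=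
    fun ⟨D', hD', hlt⟩ => ⟨D', hD', potential_lt_of_weight_lt hlt⟩
  have hXcases : X = ∅ ∨ ∃ a, X = {a} := by
    simpa [Nat.le_one_iff_eq_zero_or_eq_one, Finset.card_eq_one] using hX
  by_cases hclose : Fintype.card α ≤ (farGuards D)ᶜ.card
  · obtain ⟨s, hs1, hs⟩ := exists_isSpare hclose hunocc
    rcases hXcases with rfl | ⟨a, rfl⟩
    · exact hweight (hs.exists_answer_empty_weight_lt hs1 hunocc)
    · exact hweight (hs.exists_answer_singleton_weight_lt hs1 hunocc a)
  · have hfar : Fintype.card α < 2 * (farGuards D).card := by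
      have := Finset.card_add_card_compl (farGuards D)
      omega
    rcases hXcases with rfl | ⟨a, rfl⟩
    · obtain ⟨s, hs, -, -, -, j, hj, -⟩ := exists_farGuards_overlap hfar
      exact hweight (exists_answer_weight_lt_of_mem (mem_farGuards.1 hs) hj (by simp))
    · by_cases ha : a ∈ watched D
      · obtain ⟨s, hs, has⟩ := mem_watched.1 ha
        exact hweight (exists_answer_weight_lt_of_mem hs has subset_rfl)
      · exact exists_answer_potential_lt_of_notMem_watched hfar ha

end RelativePositions

section DiffSet

variable {α : Type*} [Fintype α] {x y : α → Bool}

/-- The set of coordinates in which two 0/1-vectors differ. It encodes the position of a bodyguard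
relative to the president. -/
def diffSet (x y : α → Bool) : Finset α := {j | x j ≠ y j}

theorem card_diffSet (x y : α → Bool) : (diffSet x y).card = hammingDist x y := rfl

theorem mem_diffSet {j : α} : j ∈ diffSet x y ↔ x j ≠ y j := by
  simp [diffSet]

theorem diffSet_comm (x y : α → Bool) : diffSet x y = diffSet y x := by
  ext j
  simp only [mem_diffSet, ne_comm]

variable [DecidableEq α]

theorem diffSet_symmDiff_diffSet (x y z : α → Bool) :
    diffSet x y ∆ diffSet y z = diffSet x z := by
  ext j
  simp only [Finset.mem_symmDiff, mem_diffSet]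
  cases x j <;> cases y j <;> cases z j <;> simp

/-- The 0/1-vector obtained from `x` by changing the coordinates in `A`. -/
def flipOn (x : α → Bool) (A : Finset α) : α → Bool := fun j => xor (x j) (decide (j ∈ A))

theorem eq_flipOn_iff {A : Finset α} : y = flipOn x A ↔ diffSet y x = A := by
  simp only [funext_iff, Finset.ext_iff, mem_diffSet, flipOn]
  refine forall_congr' fun j => ?_
  by_cases hj : j ∈ A <;> cases x j <;> cases y j <;> simp [hj]

theorem diffSet_flipOn (x : α → Bool) (A : Finset α) : diffSet (flipOn x A) x = A :=
  eq_flipOn_iff.1 rfl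

end DiffSet

section Hypercube

variable {k m : ℕ}

theorem step_hypercube_iff {x y : Fin k → Bool} :
    Step (hypercube k) x y ↔ hammingDist x y ≤ 1 := by
  change x = y ∨ hammingDist x y = 1 ↔ _
  rw [← hammingDist_eq_zero]
  omega

theorem hypercube_adj_iff {x y : Fin k → Bool} :
    (hypercube k).Adj x y ↔ ∃ j, y = flipOn x {j} := by
  simp only [eq_flipOn_iff, ← Finset.card_eq_one, card_diffSet, hammingDist_comm y]
  rfl

theorem surrounded_hypercube_iff {b : Fin m → Fin k → Bool} {v : Fin k → Bool} :
    Surrounded (hypercube k) b v ↔ unoccupied (fun i => diffSet (b i) v) = ∅ := by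
  simp only [Surrounded, hypercube_adj_iff, forall_exists_index]
  rw [forall_comm]
  simp only [forall_eq]
  simp only [eq_flipOn_iff, Finset.eq_empty_iff_forall_notMem, mem_unoccupied,
    not_forall, not_not]

theorem hypercube_degree [(hypercube k).LocallyFinite] (x : Fin k → Bool) :
    (hypercube k).degree x = k := by
  have hneighbors : (hypercube k).neighborFinset x = Finset.univ.image fun j => flipOn x {j} := by
    ext y
    simp [hypercube_adj_iff, eq_comm]
  have hinj : Function.Injective fun j => flipOn x {j} := fun j j' h =>
    Finset.singleton_injective ((diffSet_flipOn x {j}).symm.trans (eq_flipOn_iff.1 h))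
  rw [SimpleGraph.degree, hneighbors, Finset.card_image_of_injective _ hinj, Finset.card_univ,
    Fintype.card_fin]

theorem hypercube_exists_not_step (hk : 2 ≤ k) (x : Fin k → Bool) :
    ∃ v, ¬ Step (hypercube k) x v := by
  refine ⟨flipOn x Finset.univ, ?_⟩
  rw [step_hypercube_iff, hammingDist_comm, ← card_diffSet, diffSet_flipOn, Finset.card_univ,
    Fintype.card_fin]
  omega

theorem exists_step_three_le_hammingDist (hk : 3 ≤ k) {x v : Fin k → Bool}
    (hxv : 2 ≤ hammingDist x v) : ∃ w, Step (hypercube k) v w ∧ 3 ≤ hammingDist x w := by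
  by_cases h3 : 3 ≤ hammingDist x v
  · exact ⟨v, Or.inl rfl, h3⟩
  obtain ⟨j, hj⟩ : ∃ j, j ∉ diffSet x v := by
    by_contra! hall
    rw [← card_diffSet, Finset.eq_univ_iff_forall.2 hall, Finset.card_univ, Fintype.card_fin] at h3
    exact h3 hk
  refine ⟨flipOn v {j}, Or.inr (hypercube_adj_iff.2 ⟨j, rfl⟩), ?_⟩
  have hdiff : diffSet x (flipOn v {j}) = insert j (diffSet x v) := by
    rw [← diffSet_symmDiff_diffSet x v, diffSet_comm v, diffSet_flipOn,
      Disjoint.symmDiff_eq_sup (by simpa using hj)]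
    exact Finset.union_singleton ..
  rw [← card_diffSet, hdiff, Finset.card_insert_of_notMem hj, card_diffSet]
  omega

theorem canEvade_hypercube (hk : 3 ≤ k) : CanEvade (hypercube k) := by
  intro x v hxv
  rw [step_hypercube_iff, not_le] at hxv
  obtain ⟨w, hvw, hxw⟩ := exists_step_three_le_hammingDist hk hxv
  refine ⟨w, hvw, fun y hxy hyw => ?_⟩
  rw [step_hypercube_iff] at hxy hyw
  have := hammingDist_triangle x y w
  omega

theorem lt_of_bodyguardsWin_hypercube (hk : 3 ≤ k) (h : BodyguardsWin (hypercube k) m) :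
    k < m := by
  classical
  have hedge : (hypercube k).Adj (fun _ => false) (flipOn (fun _ => false) {⟨0, by omega⟩}) :=
    hypercube_adj_iff.2 ⟨_, rfl⟩
  obtain ⟨v, hv⟩ := (canEvade_hypercube hk).exists_degree_lt
    (hypercube_exists_not_step (by omega)) (h.pos_of_adj hedge) h
  rwa [hypercube_degree] at hv

theorem IsAnswer.exists_placement {b : Fin m → Fin k → Bool} {v w : Fin k → Bool}
    {D' : Fin m → Finset (Fin k)} (h : IsAnswer (diffSet v w) (fun i => diffSet (b i) v) D') :
    ∃ b' : Fin m → Fin k → Bool, (∀ i, Step (hypercube k) (b i) (b' i)) ∧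
      (fun i => diffSet (b' i) w) = D' := by
  refine ⟨fun i => flipOn w (D' i), fun i => ?_, funext fun i => diffSet_flipOn w (D' i)⟩
  rw [step_hypercube_iff, ← card_diffSet, ← diffSet_symmDiff_diffSet _ w,
    ← diffSet_symmDiff_diffSet _ v w, diffSet_comm w, diffSet_flipOn]
  exact h i

theorem bodyguardsWin_hypercube (hm : 3 * k / 2 ≤ m) : BodyguardsWin (hypercube k) m := by
  refine bodyguardsWin_of_potential (fun b v => potential fun i => diffSet (b i) v)
    (fun b v w hvw hS => ?_) fun b v w hvw hS => ?_
  all_goals rw [step_hypercube_iff, ← card_diffSet] at hvw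
  · obtain ⟨b', hlegal, hb'⟩ := (isAnswer_self hvw fun i => diffSet (b i) v).exists_placement
    exact ⟨b', hlegal, by rwa [surrounded_hypercube_iff, hb', ← surrounded_hypercube_iff]⟩
  · rw [surrounded_hypercube_iff, ← ne_eq, ← Finset.nonempty_iff_ne_empty] at hS
    obtain ⟨D', hD', hlt⟩ := exists_answer_potential_lt (by simpa using hm) hvw hS
    obtain ⟨b', hlegal, rfl⟩ := hD'.exists_placement
    exact ⟨b', hlegal, hlt⟩

end Hypercube

end BodyguardsAndPresidents

theorem mainTheorem11 (k : ℕ) (hk : 3 ≤ k) :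
    ((k + 1 : ℕ) : ℕ∞) ≤ BodyguardsAndPresidents.bodyguardNumber (hypercube k) ∧
      BodyguardsAndPresidents.bodyguardNumber (hypercube k) ≤ ((3 * k / 2 : ℕ) : ℕ∞) := by
  constructor
  · exact le_iInf₂ fun m hm =>
      Nat.cast_le.2 (BodyguardsAndPresidents.lt_of_bodyguardsWin_hypercube hk hm)
  · exact iInf₂_le _ (BodyguardsAndPresidents.bodyguardsWin_hypercube le_rfl)
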